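/- Regard a finite simple graph $G$ with vertex set $V$ as the simplicial complex of dimension at most $1$ whose simplices are its vertices and its edges, and let $|G|\subset\mathbb{R}^V$ be its geometric realization, that is, the union of the points $e_v$ $(v\in V)$ and of the segments $[e_u,e_v]$ for all edges $\{u,v\}$ of $G$, where $(e_v)_{v\in V}$ is the standard basis of $\mathbb{R}^V$. Call $G$ planar if there is a topological embedding (a homeomorphism onto its image) of $|G|$ into the $2$-sphere $S^2$. Then the complete graph $K_5$ on $5$ vertices is not planar. -/

import Mathlib

/-- The geometric realization of an abstract simplicial complex with a finite vertex set `V`: the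
union, over the faces `s`, of the simplices in `V → ℝ` spanned by the standard basis vectors `e_v`,
`v ∈ s`. As a subset of a finite-dimensional real space it carries the subspace topology, which is
the usual topology since `V` is finite. -/
def AbstractSimplicialComplex.realization {V : Type*} [Fintype V] [DecidableEq V]
    (K : AbstractSimplicialComplex V) : Set (V → ℝ) :=
  ⋃ s ∈ K.faces, convexHull ℝ ((fun v : V => (Pi.single v 1 : V → ℝ)) '' (s : Set V))

/-- A finite simplicial complex is planar if its geometric realization embeds topologically in the
2-sphere, the unit sphere of Euclidean 3-space. No smoothness or piecewise linearity of the
embedding is required. -/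
def AbstractSimplicialComplex.IsPlanar {V : Type*} [Fintype V] [DecidableEq V]
    (K : AbstractSimplicialComplex V) : Prop :=
  ∃ f : K.realization → Metric.sphere (0 : EuclideanSpace ℝ (Fin 3)) 1, Topology.IsEmbedding f

/-- A finite simple graph is planar if it is planar as a simplicial complex of dimension at most 1,
whose faces are the one-element sets of vertices and the edges. -/
def SimpleGraph.IsPlanar {V : Type*} [Fintype V] [DecidableEq V] (G : SimpleGraph V) : Prop :=
  (Geometry.AbstractSimplicialComplex.ofSimpleGraph G).IsPlanar

/-!
The proof uses angles of difference vectors and a parity count, and works directly with continuous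
edges.

Let `z v` be the images of the vertices of `K₅` under an injective continuous map to `ℂ`. Choose for
every ordered pair of vertices a logarithm `a v w` of `z w - z v`, in such a way that `a w v` and
`a v w` differ by `± πi`. When a point `x` runs through an edge `uw` not containing `v`, the logarithm
of `x - z v` changes by `a v w - a v u` plus a multiple `n v u w` of `2πi`. If `pq` and `rs` are disjoint
edges, the difference `y - x` of a point `y` of `rs` and a point `x` of `pq` never vanishes, hence has a
continuous logarithm on the square `pq × rs`, and its total change around the boundary of the square
is zero (`logIncrement_square`). This relates the four integers `n r p q`, `n q r s`, `n s p q`, `n p r s`: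
their sum is odd precisely if `pq` and `rs` interleave in the order of the vertices
(`exists_winding_integers`). Every integer `n v u w` occurs for exactly two of the fifteen pairs of
disjoint edges, so the total is even; but five of the pairs interleave, one for every set of four
vertices (`false_of_disjoint_edges`).

To pass from the sphere to the plane, an embedding of `K₅` must miss a point of the sphere, from which
one projects stereographically. Otherwise it would be a homeomorphism; but removing two inner points
of one edge disconnects the realization of `K₅`, whereas the sphere without two points is connected.
-/

open Complex

/-! ### Continuous logarithms of paths and squares -/

theorem exists_continuous_log {A : Type*} [TopologicalSpace A] [SimplyConnectedSpace A]
    [LocallyPathConnectedSpace A] {f : A → ℂ} (hf : Continuous f) (h0 : ∀ a, f a ≠ 0) :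
    ∃ L : A → ℂ, Continuous L ∧ ∀ a, exp (L a) = f a := by
  obtain ⟨a₀⟩ : Nonempty A := inferInstance
  obtain ⟨F, ⟨-, hF⟩, -⟩ := isCoveringMapOn_exp.existsUnique_continuousMap_lifts
    (⟨f, hf⟩ : C(A, ℂ)) (exp_log (h0 a₀)) h0
  exact ⟨F, F.continuous, fun a => congrFun hF a⟩

/-- Two continuous logarithms of a path differ by a constant, since their difference takes values
in the discrete set `2πiℤ`. -/
theorem sub_eq_sub_of_exp_eq {L M : ℝ → ℂ} (hL : Continuous L) (hM : Continuous M)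
    (h : ∀ t, exp (L t) = exp (M t)) (s t : ℝ) : L t - L s = M t - M s := by
  choose n hn using fun t => exp_eq_exp_iff_exists_int.1 (h t)
  have hn' : ∀ t, (n t : ℝ) = ((L t - M t) / (2 * Real.pi * I)).re := fun t => by
    have : (L t - M t) / (2 * Real.pi * I) = n t := by
      rw [hn t]
      field_simp [two_pi_I_ne_zero]
      ring
    rw [this, intCast_re]
  have hc : Continuous n := by
    rw [Int.isClosedEmbedding_coe_real.isEmbedding.continuous_iff]
    have : ((↑) : ℤ → ℝ) ∘ n = fun t => ((L t - M t) / (2 * Real.pi * I)).re := funext hn'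
    rw [this]
    fun_prop
  have hst : n t = n s := PreconnectedSpace.constant inferInstance hc
  rw [hn t, hn s, hst]
  ring

/-- The increment from `t = 0` to `t = 1` of a continuous logarithm of the path `γ`; the path is
parametrized by the whole real line. If `γ` has no continuous logarithm, the value is `0`. -/
noncomputable def logIncrement (γ : ℝ → ℂ) : ℂ :=
  open Classical in
  if h : ∃ L : ℝ → ℂ, Continuous L ∧ ∀ t, exp (L t) = γ t then h.choose 1 - h.choose 0 else 0

theorem logIncrement_eq {γ L : ℝ → ℂ} (hL : Continuous L) (h : ∀ t, exp (L t) = γ t) :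
    logIncrement γ = L 1 - L 0 := by
  have hex : ∃ L : ℝ → ℂ, Continuous L ∧ ∀ t, exp (L t) = γ t := ⟨L, hL, h⟩
  rw [logIncrement, dif_pos hex]
  exact sub_eq_sub_of_exp_eq hex.choose_spec.1 hL
    (fun t => (hex.choose_spec.2 t).trans (h t).symm) 0 1

theorem logIncrement_neg {γ : ℝ → ℂ} (hγ : Continuous γ) (h0 : ∀ t, γ t ≠ 0) :
    logIncrement (fun t => -γ t) = logIncrement γ := by
  obtain ⟨L, hL, h⟩ := exists_continuous_log hγ h0
  rw [logIncrement_eq hL h, logIncrement_eq (L := fun t => L t + Real.pi * I) (by fun_prop)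
    (fun t => by rw [exp_add, exp_pi_mul_I, h]; ring)]
  ring

theorem exists_logIncrement_eq {γ : ℝ → ℂ} (hγ : Continuous γ) (h0 : ∀ t, γ t ≠ 0) {a b : ℂ}
    (ha : exp a = γ 0) (hb : exp b = γ 1) :
    ∃ n : ℤ, logIncrement γ = b - a + n * (2 * Real.pi * I) := by
  obtain ⟨L, hL, h⟩ := exists_continuous_log hγ h0
  obtain ⟨m, hm⟩ := exp_eq_exp_iff_exists_int.1 ((h 0).trans ha.symm)
  obtain ⟨k, hk⟩ := exp_eq_exp_iff_exists_int.1 ((h 1).trans hb.symm)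
  refine ⟨k - m, ?_⟩
  rw [logIncrement_eq hL h, hm, hk]
  push_cast
  ring

/-- A nowhere vanishing function on a square has winding number zero around the boundary. -/
theorem logIncrement_square {H : ℝ × ℝ → ℂ} (hH : Continuous H) (h0 : ∀ x, H x ≠ 0) :
    logIncrement (fun t => H (t, 0)) + logIncrement (fun t => H (1, t)) =
      logIncrement (fun t => H (0, t)) + logIncrement (fun t => H (t, 1)) := by
  obtain ⟨L, hL, h⟩ := exists_continuous_log hH h0
  rw [logIncrement_eq (L := fun t => L (t, 0)) (by fun_prop) fun t => h _,
    logIncrement_eq (L := fun t => L (1, t)) (by fun_prop) fun t => h _,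
    logIncrement_eq (L := fun t => L (0, t)) (by fun_prop) fun t => h _,
    logIncrement_eq (L := fun t => L (t, 1)) (by fun_prop) fun t => h _]
  ring

/-! ### The parity argument in the plane -/

/-- The sign recording whether two vertices appear in increasing order. -/
def orderSign {V : Type*} [LinearOrder V] (u w : V) : ℤ := if u < w then -1 else 1

/-- The integers `n v u w` compare the change of the logarithm of `x - z v`, as `x` runs through the
edge `uw`, with the difference of the logarithms chosen at the vertices. For disjoint edges `pq` and
`rs`, the four signs add up to `±2` if the edges interleave in the order of the vertices, and to `0`
otherwise, so the equation determines the parity of the sum of the four integers. -/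
theorem exists_winding_integers {V : Type*} [LinearOrder V] {z : V → ℂ} {G : V → V → ℝ → ℂ}
    (hz : Function.Injective z) (hG : ∀ u w, Continuous (G u w))
    (hG0 : ∀ u w, G u w 0 = z u) (hG1 : ∀ u w, G u w 1 = z w)
    (hv : ∀ v u w, v ≠ u → v ≠ w → ∀ t, G u w t ≠ z v)
    (he : ∀ p q r s, p ≠ r → p ≠ s → q ≠ r → q ≠ s → ∀ t t', G p q t ≠ G r s t') :
    ∃ n : V → V → V → ℤ, ∀ p q r s, p ≠ r → p ≠ s → q ≠ r → q ≠ s →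
      orderSign r q + orderSign q s + orderSign s p + orderSign p r +
        2 * (n r p q + n q r s - n p r s - n s p q) = 0 := by
  obtain ⟨a, ha, hsign⟩ : ∃ a : V → V → ℂ, (∀ v w, v ≠ w → exp (a v w) = z w - z v) ∧
      ∀ v w, v ≠ w → a v w - a w v = orderSign v w * (Real.pi * I) := by
    refine ⟨fun v w => if v < w then log (z w - z v) else log (z v - z w) + Real.pi * I,
      fun v w hvw => ?_, fun v w hvw => ?_⟩
    · dsimp only
      split_ifs
      · exact exp_log (sub_ne_zero.2 (hz.ne hvw.symm))
      · rw [exp_add, exp_log (sub_ne_zero.2 (hz.ne hvw)), exp_pi_mul_I]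
        ring
    · rcases lt_or_gt_of_ne hvw with h | h
      · simp [orderSign, h, h.not_gt]
      · simp [orderSign, h, h.not_gt]
  have hn : ∀ v u w, ∃ n : ℤ, v ≠ u → v ≠ w →
      logIncrement (fun t => G u w t - z v) = a v w - a v u + n * (2 * Real.pi * I) := by
    intro v u w
    by_cases h : v ≠ u ∧ v ≠ w
    · obtain ⟨n, hn⟩ := exists_logIncrement_eq (γ := fun t => G u w t - z v)
        ((hG u w).sub continuous_const) (fun t => sub_ne_zero.2 (hv v u w h.1 h.2 t))
        (a := a v u) (b := a v w) (by rw [ha v u h.1, hG0]) (by rw [ha v w h.2, hG1])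
      exact ⟨n, fun _ _ => hn⟩
    · exact ⟨0, fun h₁ h₂ => absurd ⟨h₁, h₂⟩ h⟩
  choose n hn using hn
  refine ⟨n, fun p q r s hpr hps hqr hqs => ?_⟩
  have hsq := logIncrement_square (H := fun x => G r s x.2 - G p q x.1)
    (((hG r s).comp continuous_snd).sub ((hG p q).comp continuous_fst))
    (fun x => sub_ne_zero.2 (he p q r s hpr hps hqr hqs _ _).symm)
  -- On the two sides where the point of `rs` is fixed, the difference vector has the opposite sign.
  have hflip : ∀ v, v ≠ p → v ≠ q → logIncrement (fun t => z v - G p q t) =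
      logIncrement (fun t => G p q t - z v) := fun v h₁ h₂ => by
    rw [← logIncrement_neg (γ := fun t => G p q t - z v) ((hG p q).sub continuous_const)
      (fun t => sub_ne_zero.2 (hv v p q h₁ h₂ t))]
    simp only [neg_sub]
  simp only [hG0, hG1] at hsq
  rw [hflip r hpr.symm hqr.symm, hflip s hps.symm hqs.symm, hn r p q hpr.symm hqr.symm,
    hn q r s hqr hqs, hn p r s hpr hps, hn s p q hps.symm hqs.symm] at hsq
  have key : (Real.pi * I : ℂ) * ((orderSign r q + orderSign q s + orderSign s p + orderSign p r +
      2 * (n r p q + n q r s - n p r s - n s p q) : ℤ) : ℂ) = 0 := by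
    push_cast
    linear_combination hsq - hsign r q hqr.symm - hsign q s hqs - hsign s p hps.symm - hsign p r hpr
  have hpi : (Real.pi * I : ℂ) ≠ 0 := mul_ne_zero (ofReal_ne_zero.2 Real.pi_ne_zero) I_ne_zero
  exact_mod_cast (mul_eq_zero.1 key).resolve_left hpi

/-- Five points of the plane cannot be joined pairwise by paths such that paths without a common
end point are disjoint. -/
theorem false_of_disjoint_edges {z : Fin 5 → ℂ} {G : Fin 5 → Fin 5 → ℝ → ℂ}
    (hz : Function.Injective z) (hG : ∀ u w, Continuous (G u w))
    (hG0 : ∀ u w, G u w 0 = z u) (hG1 : ∀ u w, G u w 1 = z w)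
    (hv : ∀ v u w, v ≠ u → v ≠ w → ∀ t, G u w t ≠ z v)
    (he : ∀ p q r s, p ≠ r → p ≠ s → q ≠ r → q ≠ s → ∀ t t', G p q t ≠ G r s t') : False := by
  obtain ⟨n, hn⟩ := exists_winding_integers hz hG hG0 hG1 hv he
  -- Three pairs of disjoint edges for each set of four vertices; the second pair interleaves.
  have key : ∀ a b c d : Fin 5, a < b → b < c → c < d →
      (∃ k, n c a b + n b c d + n a c d + n d a b = 2 * k) ∧
      (∃ k, n b a c + n c b d + n a b d + n d a c = 2 * k + 1) ∧
      (∃ k, n b a d + n d b c + n a b c + n c a d = 2 * k) := by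
    intro a b c d hab hbc hcd
    have hac := hab.trans hbc
    have hbd := hbc.trans hcd
    have had := hac.trans hcd
    have h₁ := hn a b c d hac.ne had.ne hbc.ne hbd.ne
    have h₂ := hn a c b d hab.ne had.ne hbc.ne' hcd.ne
    have h₃ := hn a d b c hab.ne hac.ne hbd.ne' hcd.ne'
    simp only [orderSign, hab, hbc, hcd, hac, hbd, hbc.not_gt, hcd.not_gt,
      hac.not_gt, had.not_gt, if_true, if_false] at h₁ h₂ h₃
    exact ⟨⟨n a c d + n d a b, by omega⟩, ⟨(n b a c + n c b d + n a b d + n d a c) / 2, by omega⟩,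
      ⟨n a b c + n c a d, by omega⟩⟩
  obtain ⟨⟨_, _⟩, ⟨_, _⟩, ⟨_, _⟩⟩ := key 0 1 2 3 (by decide) (by decide) (by decide)
  obtain ⟨⟨_, _⟩, ⟨_, _⟩, ⟨_, _⟩⟩ := key 0 1 2 4 (by decide) (by decide) (by decide)
  obtain ⟨⟨_, _⟩, ⟨_, _⟩, ⟨_, _⟩⟩ := key 0 1 3 4 (by decide) (by decide) (by decide)
  obtain ⟨⟨_, _⟩, ⟨_, _⟩, ⟨_, _⟩⟩ := key 0 2 3 4 (by decide) (by decide) (by decide)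
  obtain ⟨⟨_, _⟩, ⟨_, _⟩, ⟨_, _⟩⟩ := key 1 2 3 4 (by decide) (by decide) (by decide)
  omega

/-! ### The realization of a complete graph -/

section Realization

variable {V : Type*} [DecidableEq V]

/-- The point dividing the edge from `u` to `w` in the ratio `t : 1 - t`. -/
def edgePoint (u w : V) (t : ℝ) : V → ℝ := (1 - t) • Pi.single u 1 + t • Pi.single w 1

theorem edgePoint_apply (u w v : V) (t : ℝ) :
    edgePoint u w t v = (1 - t) * (if v = u then 1 else 0) + t * (if v = w then 1 else 0) := by
  simp [edgePoint, Pi.single_apply]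

theorem continuous_edgePoint (u w : V) : Continuous (edgePoint u w) := by
  unfold edgePoint
  fun_prop

theorem edgePoint_ne {p q r s : V} (hpr : p ≠ r) (hps : p ≠ s) (hqr : q ≠ r) (hqs : q ≠ s)
    (t t' : ℝ) : edgePoint p q t ≠ edgePoint r s t' := by
  intro h
  have h₁ := congrFun h p
  have h₂ := congrFun h q
  simp only [edgePoint_apply, if_neg hpr, if_neg hps, if_neg hqr, if_neg hqs, if_true] at h₁ h₂
  by_cases hpq : p = q
  · simp [hpq] at h₁
  · simp [hpq, Ne.symm hpq] at h₁ h₂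
    linarith

variable [Fintype V]

/-- The geometric realization of the complete graph on `V`. -/
abbrev completeGraphRealization (V : Type*) [Fintype V] [DecidableEq V] : Set (V → ℝ) :=
  (Geometry.AbstractSimplicialComplex.ofSimpleGraph
    (SimpleGraph.completeGraph V)).realization

theorem mem_completeGraphRealization {x : V → ℝ} :
    x ∈ completeGraphRealization V ↔ ∃ u w, ∃ t ∈ Set.Icc (0 : ℝ) 1, edgePoint u w t = x := by
  have hpair : ∀ u w : V, ((fun v : V => (Pi.single v 1 : V → ℝ)) '' (({u, w} : Finset V) : Set V)) =
      {Pi.single u 1, Pi.single w 1} := fun u w => by simp [Set.image_pair]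
  simp only [completeGraphRealization, AbstractSimplicialComplex.realization, Set.mem_iUnion]
  constructor
  · rintro ⟨s, hs, hx⟩
    obtain ⟨u, w, rfl⟩ : ∃ u w, s = {u, w} := by
      rcases hs with ⟨v, rfl⟩ | ⟨e, -, rfl⟩
      · exact ⟨v, v, by simp⟩
      · induction e with | h u w => exact ⟨u, w, by ext; simp⟩
    rw [hpair, convexHull_pair, segment_eq_image] at hx
    obtain ⟨t, ht, rfl⟩ := hx
    exact ⟨u, w, t, ht, rfl⟩
  · rintro ⟨u, w, t, ht, rfl⟩
    refine ⟨{u, w}, ?_, ?_⟩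
    · by_cases h : u = w
      · exact Or.inl ⟨u, by simp [h]⟩
      · exact Or.inr ⟨s(u, w), by simpa using h, by ext; simp⟩
    · rw [hpair, convexHull_pair, segment_eq_image]
      exact ⟨t, ht, rfl⟩

/-- The two points of an edge at one third and two thirds of its length separate the realization. -/
theorem not_isPreconnected_compl_edge_points {u w : V} (huw : u ≠ w)
    {A : Set (completeGraphRealization V)}
    (hA : ∀ x, x ∈ A ↔ x.1 ≠ edgePoint u w (1 / 3) ∧ x.1 ≠ edgePoint u w (2 / 3)) :
    ¬ IsPreconnected A := by
  intro hconn
  have hc : ∀ v : V, Continuous fun x : completeGraphRealization V => x.1 v := fun v =>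
    (continuous_apply v).comp continuous_subtype_val
  have hmem : ∀ t ∈ Set.Icc (0 : ℝ) 1, edgePoint u w t ∈ completeGraphRealization V := fun t ht =>
    mem_completeGraphRealization.2 ⟨u, w, t, ht, rfl⟩
  have hu : ∀ t, edgePoint u w t u = 1 - t := fun t => by simp [edgePoint_apply, huw]
  have hw : ∀ t, edgePoint u w t w = t := fun t => by simp [edgePoint_apply, huw.symm]
  have hin : ∀ t ∈ Set.Icc (0 : ℝ) 1, t ≠ 1 / 3 → t ≠ 2 / 3 → ∀ h, ⟨edgePoint u w t, h⟩ ∈ A :=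
    fun t _ h₁ h₂ _ => (hA _).2 ⟨fun e => h₁ (by simpa [hw] using congrFun e w),
      fun e => h₂ (by simpa [hw] using congrFun e w)⟩
  obtain ⟨x, -, ⟨hx₁, hx₂⟩, hx₃⟩ := hconn
    ({x | 1 / 3 < x.1 u} ∩ {x | 1 / 3 < x.1 w}) ({x | x.1 u < 1 / 3} ∪ {x | x.1 w < 1 / 3})
    ((isOpen_lt continuous_const (hc u)).inter (isOpen_lt continuous_const (hc w)))
    ((isOpen_lt (hc u) continuous_const).union (isOpen_lt (hc w) continuous_const))
    (by
      rintro ⟨x, hx⟩ hxA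
      obtain ⟨h₁, h₂⟩ := (hA _).1 hxA
      by_contra hcon
      simp only [Set.mem_union, Set.mem_inter_iff, Set.mem_ofPred_eq, not_or, not_lt, not_and]
        at hcon h₁ h₂
      obtain ⟨hcon, hxu, hxw⟩ := hcon
      -- A point with positive coordinates at `u` and `w` lies on the edge `uw`.
      obtain ⟨t, rfl⟩ : ∃ t, edgePoint u w t = x := by
        obtain ⟨p, q, t, -, rfl⟩ := mem_completeGraphRealization.1 hx
        rw [edgePoint_apply] at hxu hxw
        by_cases hup : u = p
        · by_cases hwq : w = q
          · exact ⟨t, by rw [hup, hwq]⟩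
          · have hwp : w ≠ p := fun h => huw (hup.trans h.symm)
            simp only [if_neg hwp, if_neg hwq] at hxw
            linarith
        · by_cases huq : u = q
          · by_cases hwp : w = p
            · refine ⟨1 - t, ?_⟩
              rw [huq, hwp, edgePoint, edgePoint, add_comm, sub_sub_cancel]
            · have hwq : w ≠ q := fun h => huw (huq.trans h.symm)
              simp only [if_neg hwp, if_neg hwq] at hxw
              linarith
          · simp only [if_neg hup, if_neg huq] at hxu
            linarith
      rw [hu] at hcon hxu
      rw [hw] at hcon hxw
      rcases eq_or_lt_of_le hxw with h | h
      · exact h₁ (by rw [h])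
      · have ht : t = 2 / 3 := by
          by_contra hne
          have hlt : t < 2 / 3 := lt_of_le_of_ne (by linarith) hne
          linarith [hcon (by linarith)]
        exact h₂ (by rw [ht]))
    ⟨⟨edgePoint u w (1 / 2), hmem _ (by norm_num)⟩,
      hin _ (by norm_num) (by norm_num) (by norm_num) _, by simp [hu]; norm_num,
      by simp [hw]; norm_num⟩
    ⟨⟨edgePoint u w 0, hmem _ (by norm_num)⟩,
      hin _ (by norm_num) (by norm_num) (by norm_num) _, Or.inr (by simp [hw])⟩
  simp only [Set.mem_union, Set.mem_ofPred_eq] at hx₁ hx₂ hx₃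
  rcases hx₃ with h | h <;> linarith

end Realization

/-! ### From the sphere to the plane -/

theorem isPreconnected_sphere_compl_pair
    (p q : Metric.sphere (0 : EuclideanSpace ℝ (Fin 3)) 1) (hpq : q ≠ p) :
    IsPreconnected ({p, q}ᶜ : Set (Metric.sphere (0 : EuclideanSpace ℝ (Fin 3)) 1)) := by
  have : Fact (Module.finrank ℝ (EuclideanSpace ℝ (Fin 3)) = 2 + 1) := ⟨by simp⟩
  let φ := stereographic' 2 p
  have hsrc : φ.source = {p}ᶜ := stereographic'_source p
  have htgt : φ.target = Set.univ := stereographic'_target p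
  have hrank : 1 < Module.rank ℝ (EuclideanSpace ℝ (Fin 2)) := by
    rw [← Module.finrank_eq_rank]
    simp
  have himg : ({p, q}ᶜ : Set (Metric.sphere (0 : EuclideanSpace ℝ (Fin 3)) 1)) =
      φ.symm '' {φ q}ᶜ := by
    ext x
    simp only [Set.mem_compl_iff, Set.mem_insert_iff, Set.mem_singleton_iff, not_or, Set.mem_image]
    constructor
    · rintro ⟨hxp, hxq⟩
      have hx : x ∈ φ.source := by rw [hsrc]; exact hxp
      exact ⟨φ x, fun h => hxq (φ.injOn hx (by rw [hsrc]; exact hpq) h), φ.left_inv hx⟩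
    · rintro ⟨y, hy, rfl⟩
      have hyt : y ∈ φ.target := by rw [htgt]; trivial
      refine ⟨?_, fun h => hy (by rw [← h, φ.right_inv hyt])⟩
      have := φ.map_target hyt
      rw [hsrc] at this
      exact this
  rw [himg]
  refine (isConnected_compl_singleton_of_one_lt_rank hrank _).isPreconnected.image _ ?_
  exact φ.continuousOn_symm.mono (by rw [htgt]; exact Set.subset_univ _)

theorem not_surjective_of_isEmbedding {V : Type*} [Fintype V] [DecidableEq V] [Nontrivial V]
    {f : completeGraphRealization V → Metric.sphere (0 : EuclideanSpace ℝ (Fin 3)) 1}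
    (hf : Topology.IsEmbedding f) : ¬ Function.Surjective f := by
  intro hsurj
  obtain ⟨u, w, huw⟩ := exists_pair_ne V
  let h := hf.toHomeomorphOfSurjective hsurj
  have hmem : ∀ t ∈ Set.Icc (0 : ℝ) 1, edgePoint u w t ∈ completeGraphRealization V := fun t ht =>
    mem_completeGraphRealization.2 ⟨u, w, t, ht, rfl⟩
  let a : completeGraphRealization V := ⟨edgePoint u w (1 / 3), hmem _ (by norm_num)⟩
  let b : completeGraphRealization V := ⟨edgePoint u w (2 / 3), hmem _ (by norm_num)⟩
  have hab : b ≠ a := fun e => by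
    have := congrFun (congrArg Subtype.val e) w
    simp [a, b, edgePoint_apply, huw.symm] at this
    norm_num at this
  have hconn := (isPreconnected_sphere_compl_pair (h a) (h b) (h.injective.ne hab)).image h.symm
    h.symm.continuous.continuousOn
  refine not_isPreconnected_compl_edge_points huw (fun x => ?_) hconn
  rw [h.symm.image_eq_preimage_symm, Homeomorph.symm_symm]
  simp only [Set.mem_preimage, Set.mem_compl_iff, Set.mem_insert_iff, Set.mem_singleton_iff, not_or,
    h.injective.eq_iff, ne_eq, Subtype.ext_iff, a, b]

/-- A planar complete graph with at least two vertices embeds in the plane. -/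
theorem exists_continuous_injective_complex {V : Type*} [Fintype V] [DecidableEq V] [Nontrivial V]
    (h : (SimpleGraph.completeGraph V).IsPlanar) :
    ∃ g : completeGraphRealization V → ℂ, Continuous g ∧ Function.Injective g := by
  obtain ⟨f, hf⟩ := h
  obtain ⟨p, hp⟩ := not_forall.1 (not_surjective_of_isEmbedding hf)
  have hp' : ∀ x, f x ≠ p := fun x hx => hp ⟨x, hx⟩
  have : Fact (Module.finrank ℝ (EuclideanSpace ℝ (Fin 3)) = 2 + 1) := ⟨by simp⟩
  let φ := stereographic' 2 p
  have hsrc : ∀ x, f x ∈ φ.source := fun x => by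
    rw [stereographic'_source]
    exact hp' x
  let e := orthonormalBasisOneI.repr.symm
  refine ⟨fun x => e (φ (f x)), e.continuous.comp (φ.continuousOn.comp_continuous hf.continuous hsrc),
    fun x y hxy => hf.injective (φ.injOn (hsrc x) (hsrc y) (e.injective hxy))⟩

theorem corollary4p6 : ¬ (SimpleGraph.completeGraph (Fin 5)).IsPlanar := by
  intro h
  obtain ⟨g, hg, hinj⟩ := exists_continuous_injective_complex h
  -- Clamping the parameter to the unit interval extends the edges to paths on the real line.
  let c : ℝ → ℝ := fun t => Set.projIcc (0 : ℝ) 1 zero_le_one t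
  have hc : Continuous c := continuous_subtype_val.comp continuous_projIcc
  have hc0 : c 0 = 0 := by simp [c]
  have hc1 : c 1 = 1 := by simp [c]
  let P : Fin 5 → Fin 5 → ℝ → completeGraphRealization (Fin 5) := fun u w t =>
    ⟨edgePoint u w (c t), mem_completeGraphRealization.2 ⟨u, w, c t, Subtype.prop _, rfl⟩⟩
  have hP : ∀ p q r s, p ≠ r → p ≠ s → q ≠ r → q ≠ s → ∀ t t', g (P p q t) ≠ g (P r s t') :=
    fun p q r s h₁ h₂ h₃ h₄ t t' => hinj.ne fun e =>
      edgePoint_ne h₁ h₂ h₃ h₄ _ _ (congrArg Subtype.val e)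
  have hP0 : ∀ u w, P u w 0 = P u u 0 := fun u w =>
    Subtype.ext (by simp [P, hc0, edgePoint])
  have hP1 : ∀ u w, P u w 1 = P w w 0 := fun u w =>
    Subtype.ext (by simp [P, hc0, hc1, edgePoint])
  refine false_of_disjoint_edges (z := fun v => g (P v v 0)) (G := fun u w t => g (P u w t))
    (fun v w e => ?_) (fun u w => ?_) (fun u w => congrArg g (hP0 u w))
    (fun u w => congrArg g (hP1 u w)) (fun v u w h₁ h₂ t => hP u w v v h₁.symm h₁.symm h₂.symm
      h₂.symm t 0) hP
  · by_contra hne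
    exact hP v v w w hne hne hne hne 0 0 e
  · exact hg.comp (((continuous_edgePoint u w).comp hc).subtype_mk _)
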